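/- Let $p^*\in[0,1]$, $a=a(p^*)=p^*(1-p^*)$, let $(X_j)_{j\ge 1}$ be independent Bernoulli$(p^*)$ random variables, and let $n$ be a positive integer with $(n-2)\,a\ge 8$. For $2\le j\le n$ put $$\mathbb I_j=X_j(1-X_{j-1}),\qquad W=\sum_{j=2}^n \mathbb I_j,\qquad W^{(i)}=W-\mathbb I_i\quad(2\le i\le n).$$ For a finite signed measure $\mu$ on $\mathbb Z$ let $\|\mu\|_{TV}=\sum_{k\in\mathbb Z}|\mu(\{k\})|$, let $*$ denote convolution, let $I_1$ and $I$ be the point masses at $1$ and $0$, and let $\mathcal L(Y)$ be the law of $Y$. Define $$d=\big\|\mathcal L(W)*(I_1-I)^{*2}\big\|_{TV},\qquad d_1=\max_{2\le i\le n}\big\|\mathcal L(W^{(i)})*(I_1-I)^{*2}\big\|_{TV},$$ $$K_1=\frac{288\,(1-3a)}{a},\qquad K_2=\frac{4}{a\sqrt{\min\{1-a,\,1/2\}}}.$$ Then $$d\le\frac{K_1}{n-1}+\frac{K_2}{\sqrt{n-1}}\qquad\text{and}\qquad d_1\le\frac{K_1}{n-2}+\frac{K_2}{\sqrt{n-2}}.$$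 -/

import Mathlib

open MeasureTheory ProbabilityTheory

noncomputable section

namespace Runs

/-- The mass function `k ↦ P(Y = k)` of an integer-valued random variable `Y`, i.e. the law
`ℒ(Y)` regarded as a (finite signed) measure on `ℤ`. -/
def law {Ω : Type*} [MeasurableSpace Ω] (P : Measure Ω) (Y : Ω → ℤ) : ℤ → ℝ :=
  fun k => P.real {ω | Y ω = k}

/-- The mass function of the degenerate distribution concentrated at `m`. -/
def degenerate (m : ℤ) : ℤ → ℝ := Pi.single m 1

/-- Convolution of signed measures on `ℤ`, given by their mass functions:
`(f * g)(k) = ∑_{a + b = k} f(a) g(b)`. -/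
def conv (f g : ℤ → ℝ) : ℤ → ℝ :=
  DiscreteConvolution.addConvolution (LinearMap.mul ℝ ℝ) f g

/-- Total variation norm `‖f‖_TV = ∑_k |f(k)|` of a signed measure on `ℤ` (for a difference of two
probability laws this is twice the total variation distance). -/
def tvNorm (f : ℤ → ℝ) : ℝ := ∑' k, |f k|

/-- The signed measure `I₁ - I`, where `I₁` and `I` are the degenerate distributions at `1` and
`0`. -/
def diffMeasure : ℤ → ℝ := degenerate 1 - degenerate 0

/-- `‖ℒ(Y) * (I₁ - I)^{*2}‖_TV`. -/
def secondDiffNorm {Ω : Type*} [MeasurableSpace Ω] (P : Measure Ω) (Y : Ω → ℤ) : ℝ :=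
  tvNorm (conv (law P Y) (conv diffMeasure diffMeasure))

/-- The `(1,1)`-run indicator `𝕀_j = X_j (1 - X_{j-1})` (used for `j ≥ 2`). -/
def runInd {Ω : Type*} (X : ℕ → Ω → ℤ) (j : ℕ) : Ω → ℤ :=
  fun ω => X j ω * (1 - X (j - 1) ω)

/-- `W = ∑_{j=2}^n 𝕀_j`. -/
def W {Ω : Type*} (X : ℕ → Ω → ℤ) (n : ℕ) : Ω → ℤ :=
  fun ω => ∑ j ∈ Finset.Icc 2 n, runInd X j ω

/-- `W^{(i)} = W - 𝕀_i`. -/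
def Wdel {Ω : Type*} (X : ℕ → Ω → ℤ) (n i : ℕ) : Ω → ℤ :=
  fun ω => W X n ω - runInd X i ω

/-- `d = ‖ℒ(W) * (I₁ - I)^{*2}‖_TV`. -/
def d {Ω : Type*} [MeasurableSpace Ω] (P : Measure Ω) (X : ℕ → Ω → ℤ) (n : ℕ) : ℝ :=
  secondDiffNorm P (W X n)

/-- `d₁ = max_{2 ≤ i ≤ n} ‖ℒ(W^{(i)}) * (I₁ - I)^{*2}‖_TV`; the index set is finite, and non-empty
for `n ≥ 2`, so the supremum is a maximum. -/
def d₁ {Ω : Type*} [MeasurableSpace Ω] (P : Measure Ω) (X : ℕ → Ω → ℤ) (n : ℕ) : ℝ :=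
  ⨆ i : Finset.Icc 2 n, secondDiffNorm P (Wdel X n i)

/-- `a(p) = p (1 - p)`. -/
def a (p : ℝ) : ℝ := p * (1 - p)

/-- `K₁ = 288 (1 - 3 a(p)) / a(p)`. -/
def K₁ (p : ℝ) : ℝ := 288 * (1 - 3 * a p) / a p

/-- `K₂ = 4 / (a(p) √(min {1 - a(p), 1/2}))`. -/
def K₂ (p : ℝ) : ℝ := 4 / (a p * √(min (1 - a p) (1 / 2)))

end Runs

end

/-!
A second difference is a difference of two first differences, so it is enough to bound first
differences of the law of the count by a multiple of `1 / √(a n)`; as `a ≤ 1 / 4`, this is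
already below the `K₂` term.

The smoothness comes from independent Bernoulli variables hidden in the count. Cut the sequence
into disjoint blocks of three variables and condition on the first and third of each block. If these
agree, the middle variable `Y` adds `Y` or `1 - Y` to a deterministic quantity; if they differ, the
contribution of the block is deterministic (`runExp_three`). The number of blocks that agree is
binomial with success probability `p² + (1 - p)² ≥ 1 / 2`. A deleted indicator costs at most a
bounded number of blocks, so `W` and `W^{(i)}` are treated alike.

A sum of `k` independent Bernoulli(`s`) variables has first differences of total variation at most
`1 / √((k + 1) s (1 - s))`. By the score identity (`bernStep_iterate_score`) the first difference of
the law of `S_k` is the law of `S_{k+1}` weighted by its centred and normalised value, whose mean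
absolute value is controlled by the variance. Averaging over the random number of blocks uses
`E[1 / (S + 1)] ≤ 1 / ((M + 1) r)` for a binomial `S` with parameters `M` and `r`
(`binomRecip_le`). To make this average linear, the square root is replaced by
`2 √y ≤ μ + y / μ`, with `μ` chosen at the end.

Everything is carried out on test functions: the law of the count enters through the expectation
operators `runStep`, which commute with translations and hence with the Bernoulli smoothing
`bernStep`, so that the averaging over blocks becomes an induction (`Smoothing`). Conditional
expectations are needed only for the one-step formula `integral_runStep`.
-/

namespace Runs

/-! ### Smoothing by Bernoulli variables -/

/-- The operator `f ↦ E f(· + ξ)` for a Bernoulli(`s`) variable `ξ`. -/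
def bernStep (s : ℝ) (f : ℤ → ℝ) : ℤ → ℝ := fun w => s * f (w + 1) + (1 - s) * f w

lemma bernStep_comm (s t : ℝ) : Function.Commute (bernStep s) (bernStep t) := by
  intro f
  funext w
  simp only [bernStep]
  ring

lemma bernStep_iterate_smul_add (s c d : ℝ) (k : ℕ) (f g : ℤ → ℝ) :
    (bernStep s)^[k] (fun w => c * f w + d * g w) =
      fun w => c * (bernStep s)^[k] f w + d * (bernStep s)^[k] g w := by
  induction k generalizing f g with
  | zero => rfl
  | succ k ih =>
    simp only [Function.iterate_succ_apply]
    rw [← ih]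
    congr 1
    funext w
    simp only [bernStep]
    ring

lemma bernStep_iterate_mono {s : ℝ} (h0 : 0 ≤ s) (h1 : s ≤ 1) (k : ℕ) {f g : ℤ → ℝ}
    (h : ∀ w, f w ≤ g w) (w : ℤ) : (bernStep s)^[k] f w ≤ (bernStep s)^[k] g w := by
  induction k generalizing f g with
  | zero => exact h w
  | succ k ih =>
    simp only [Function.iterate_succ_apply]
    refine ih fun v => ?_
    have hs : 0 ≤ 1 - s := by linarith
    simp only [bernStep]
    gcongr
    exacts [h _, h _]

lemma bernStep_iterate_const (s c : ℝ) (k : ℕ) :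
    (bernStep s)^[k] (fun _ => c) = fun _ => c := by
  refine Function.iterate_fixed ?_ k
  funext w
  simp only [bernStep]
  ring

lemma abs_bernStep_iterate_le {s : ℝ} (h0 : 0 ≤ s) (h1 : s ≤ 1) (k : ℕ) {f g : ℤ → ℝ}
    (h : ∀ w, |f w| ≤ g w) (w : ℤ) : |(bernStep s)^[k] f w| ≤ (bernStep s)^[k] g w := by
  have hneg : (bernStep s)^[k] (fun v => -f v) w = -(bernStep s)^[k] f w := by
    have := congrFun (bernStep_iterate_smul_add s (-1) 0 k f f) w
    simpa using this
  rw [abs_le, neg_le, ← hneg]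
  exact ⟨bernStep_iterate_mono h0 h1 k (fun v => (neg_le_abs _).trans (h v)) w,
    bernStep_iterate_mono h0 h1 k (fun v => (le_abs_self _).trans (h v)) w⟩

/-- The second moment of a binomial variable about an arbitrary centre. -/
lemma bernStep_iterate_sq (s c : ℝ) (k : ℕ) (w : ℤ) :
    (bernStep s)^[k] (fun v => ((v : ℝ) - c) ^ 2) w =
      (w + k * s - c) ^ 2 + k * (s * (1 - s)) := by
  induction k generalizing w with
  | zero => simp
  | succ k ih =>
    rw [Function.iterate_succ_apply']
    simp only [bernStep, ih]
    push_cast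
    ring

/-- The score identity of the binomial law: if `S_k` is binomial with parameters `k` and `s`, then
`E[f(w + S_{k+1}) (w + S_{k+1} - c)] = (w + (k + 1) s - c) E[f(w + S_{k+1})]
+ (k + 1) s (1 - s) E[f(w + S_k + 1) - f(w + S_k)]`. -/
lemma bernStep_iterate_score (s c : ℝ) (k : ℕ) (f : ℤ → ℝ) (w : ℤ) :
    (bernStep s)^[k + 1] (fun v => f v * (v - c)) w =
      (w + (k + 1) * s - c) * (bernStep s)^[k + 1] f w +
        (k + 1) * (s * (1 - s)) * ((bernStep s)^[k] f (w + 1) - (bernStep s)^[k] f w) := by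
  induction k generalizing w with
  | zero =>
    simp only [Function.iterate_succ_apply, Function.iterate_zero, id, bernStep]
    push_cast
    ring
  | succ k ih =>
    rw [Function.iterate_succ_apply', Function.iterate_succ_apply' (bernStep s) (k + 1) f,
      bernStep, ih, ih, Function.iterate_succ_apply' (bernStep s) k f]
    simp only [bernStep]
    push_cast
    ring

/-- The first difference of a binomial law has total variation at most
`1 / √((k + 1) s (1 - s))`; the square root is linearised with a free parameter `μ`, so that the
bound can later be averaged over a random `k`. -/
lemma abs_bernStep_iterate_diff_le {s μ : ℝ} (h0 : 0 < s) (h1 : s < 1) (hμ : 0 < μ) (k : ℕ)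
    {f : ℤ → ℝ} (hf : ∀ w, |f w| ≤ 1) (w : ℤ) :
    |(bernStep s)^[k] f (w + 1) - (bernStep s)^[k] f w| ≤
      μ / 2 + 1 / (2 * μ * (s * (1 - s)) * (k + 1)) := by
  have hs : 0 < s * (1 - s) := mul_pos h0 (by linarith)
  have hk : (0 : ℝ) < k + 1 := by positivity
  set D : ℝ := (k + 1) * (s * (1 - s)) with hD
  have hD0 : 0 < D := mul_pos hk hs
  -- centring at the mean kills the first term of the score identity
  set c : ℝ := w + (k + 1) * s with hc
  have hscore := bernStep_iterate_score s c k f w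
  rw [← hc, sub_self, zero_mul, zero_add, ← hD] at hscore
  have hpt : ∀ v : ℤ, |f v * (v - c)| ≤ μ / 2 * ((v : ℝ) - c) ^ 2 + 1 / (2 * μ) * 1 := by
    intro v
    have h1 : |f v * (v - c)| ≤ |(v : ℝ) - c| := by
      rw [abs_mul]
      exact mul_le_of_le_one_left (abs_nonneg _) (hf v)
    have h2 : μ / 2 * ((v : ℝ) - c) ^ 2 + 1 / (2 * μ) * 1 - |(v : ℝ) - c| =
        (μ * |(v : ℝ) - c| - 1) ^ 2 / (2 * μ) := by
      rw [← sq_abs ((v : ℝ) - c)]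
      field_simp
      ring
    have h3 : 0 ≤ (μ * |(v : ℝ) - c| - 1) ^ 2 / (2 * μ) := by positivity
    linarith
  have hmain := abs_bernStep_iterate_le h0.le h1.le (k + 1) hpt w
  rw [bernStep_iterate_smul_add s _ _ _ (fun v : ℤ => ((v : ℝ) - c) ^ 2) (fun _ => 1)] at hmain
  simp only [bernStep_iterate_sq, bernStep_iterate_const] at hmain
  rw [hscore, abs_mul, abs_of_pos hD0] at hmain
  have hvar : ((w : ℝ) + ((k + 1 : ℕ) : ℝ) * s - c) ^ 2 + ((k + 1 : ℕ) : ℝ) * (s * (1 - s)) = D := by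
    rw [hc, hD]
    push_cast
    ring
  rw [hvar] at hmain
  refine le_of_mul_le_mul_left (hmain.trans_eq ?_) hD0
  have hden : 2 * μ * (s * (1 - s)) * (k + 1) = 2 * μ * D := by
    rw [hD]
    ring
  rw [hden]
  field_simp

/-- The first-difference bound after smoothing with two kinds of Bernoulli variables, in terms of
their total number only. -/
lemma abs_bernStep_pair_diff_le {s μ : ℝ} (h0 : 0 < s) (h1 : s < 1) (hμ : 0 < μ) (i j : ℕ)
    {f : ℤ → ℝ} (hf : ∀ w, |f w| ≤ 1) (w : ℤ) :
    |(bernStep s)^[i] ((bernStep (1 - s))^[j] f) (w + 1) -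
      (bernStep s)^[i] ((bernStep (1 - s))^[j] f) w| ≤
      μ / 2 + 1 / (μ * (s * (1 - s))) * (1 / ((i + j : ℕ) + 1)) := by
  -- the larger of the two exponents carries the bound, the other operator is a contraction
  have hcontr : ∀ {t : ℝ}, 0 ≤ t → t ≤ 1 → ∀ (k : ℕ) (v : ℤ), |(bernStep t)^[k] f v| ≤ 1 := by
    intro t ht0 ht1 k v
    have := abs_bernStep_iterate_le ht0 ht1 k hf v
    rwa [bernStep_iterate_const] at this
  have hs : 0 < s * (1 - s) := mul_pos h0 (by linarith)
  have key : ∀ k : ℕ, ((i + j : ℕ) : ℝ) + 1 ≤ 2 * (k + 1) →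
      μ / 2 + 1 / (2 * μ * (s * (1 - s)) * (k + 1)) ≤
        μ / 2 + 1 / (μ * (s * (1 - s))) * (1 / ((i + j : ℕ) + 1)) := by
    intro k hk
    rw [one_div_mul_one_div]
    refine add_le_add_right (one_div_le_one_div_of_le (by positivity) ?_) _
    linarith [mul_le_mul_of_nonneg_left hk (mul_pos hμ hs).le]
  rcases le_total j i with hij | hij
  · refine (abs_bernStep_iterate_diff_le h0 h1 hμ i (hcontr (by linarith) (by linarith) j) w).trans
      (key i ?_)
    have : (j : ℝ) ≤ i := by exact_mod_cast hij
    push_cast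
    linarith
  · rw [(bernStep_comm s (1 - s)).iterate_iterate i j f]
    have := abs_bernStep_iterate_diff_le (s := 1 - s) (by linarith) (by linarith) hμ j
      (hcontr h0.le h1.le i) w
    rw [sub_sub_cancel, mul_comm (1 - s) s] at this
    refine this.trans (key j ?_)
    have : (i : ℝ) ≤ j := by exact_mod_cast hij
    push_cast
    linarith

/-! ### Reciprocal moments of a binomial variable -/

/-- `E[1 / (N + 1 + S)]` for a binomial variable `S` with parameters `M` and `r`, written as the
integral of `s ^ N` times the probability generating function of `S`. -/
noncomputable def binomRecip (r : ℝ) (M N : ℕ) : ℝ := ∫ s in (0 : ℝ)..1, s ^ N * (1 - r + r * s) ^ M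

lemma binomRecip_zero (r : ℝ) (N : ℕ) : binomRecip r 0 N = 1 / (N + 1) := by
  simp [binomRecip]

lemma binomRecip_succ (r : ℝ) (M N : ℕ) :
    binomRecip r (M + 1) N = r * binomRecip r M (N + 1) + (1 - r) * binomRecip r M N := by
  simp only [binomRecip]
  rw [← intervalIntegral.integral_const_mul, ← intervalIntegral.integral_const_mul,
    ← intervalIntegral.integral_add (Continuous.intervalIntegrable (by fun_prop) _ _)
      (Continuous.intervalIntegrable (by fun_prop) _ _)]
  congr 1
  funext s
  ring

lemma binomRecip_le {r : ℝ} (h0 : 0 < r) (h1 : r ≤ 1) (M : ℕ) :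
    binomRecip r M 0 ≤ 1 / ((M + 1) * r) := by
  have hM : (0 : ℝ) < M + 1 := by positivity
  have hder : ∀ s ∈ Set.uIcc (0 : ℝ) 1,
      HasDerivAt (fun s : ℝ => (1 - r + r * s) ^ (M + 1) / ((M + 1) * r))
        (s ^ 0 * (1 - r + r * s) ^ M) s := by
    intro s _
    have h := ((((hasDerivAt_id s).const_mul r).const_add (1 - r)).pow (M + 1)).div_const
      ((M + 1) * r)
    refine h.congr_deriv ?_
    simp only [id, Nat.add_sub_cancel]
    push_cast
    field_simp
  rw [binomRecip, intervalIntegral.integral_eq_sub_of_hasDerivAt hder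
    (Continuous.intervalIntegrable (by fun_prop) _ _)]
  have : 0 ≤ (1 - r + r * 0) ^ (M + 1) / ((M + 1) * r) :=
    div_nonneg (pow_nonneg (by linarith) _) (by positivity)
  have h2 : (1 - r + r * 1) = 1 := by ring
  rw [h2, one_pow]
  linarith

/-! ### The transition operators of the run count -/

/-- One step of the chain `(X_k, V_k)`, where `V_k = V_{k-1} + e X_k (1 - X_{k-1})`:
`runStep p e F x w` is the conditional expectation of `F X_k V_k` given `X_{k-1} = x`
and `V_{k-1} = w`. The weight `e` is `1` if the indicator is counted and `0` if it is deleted. -/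
def runStep (p : ℝ) (e : ℤ) (F : ℤ → ℤ → ℝ) : ℤ → ℤ → ℝ :=
  fun x w => p * F 1 (w + e * (1 - x)) + (1 - p) * F 0 w

/-- Successive steps of the chain, with the weights listed in chronological order. -/
def runExp (p : ℝ) (l : List ℤ) (F : ℤ → ℤ → ℝ) : ℤ → ℤ → ℝ := l.foldr (runStep p) F

lemma runExp_cons (p : ℝ) (e : ℤ) (l : List ℤ) (F : ℤ → ℤ → ℝ) (x w : ℤ) :
    runExp p (e :: l) F x w =
      p * runExp p l F 1 (w + e * (1 - x)) + (1 - p) * runExp p l F 0 w := rfl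

lemma runExp_append_singleton (p : ℝ) (l : List ℤ) (e : ℤ) (F : ℤ → ℤ → ℝ) :
    runExp p (l ++ [e]) F = runExp p l (runStep p e F) := by
  simp [runExp]

lemma runExp_bernStep (p s : ℝ) (l : List ℤ) (f : ℤ → ℝ) (x w : ℤ) :
    runExp p l (fun _ => bernStep s f) x w = bernStep s (runExp p l (fun _ => f) x) w := by
  induction l generalizing x w with
  | nil => rfl
  | cons e l ih =>
    simp only [runExp_cons, ih, bernStep]
    rw [add_right_comm w 1]
    ring

lemma runExp_diff (p : ℝ) (l : List ℤ) (f : ℤ → ℝ) (x w : ℤ) :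
    runExp p l (fun _ v => f (v + 1) - f v) x w =
      runExp p l (fun _ => f) x (w + 1) - runExp p l (fun _ => f) x w := by
  induction l generalizing x w with
  | nil => rfl
  | cons e l ih =>
    simp only [runExp_cons, ih]
    rw [add_right_comm w 1]
    ring

/-- Three counted steps, conditioned on the first and the third of the new variables. If these two
agree, the count gains a Bernoulli variable that depends only on the middle one, which acts as
a `bernStep`; if they differ, the gain is deterministic. -/
lemma runExp_three (p : ℝ) (l : List ℤ) (f : ℤ → ℝ) (x w : ℤ) :
    runExp p (1 :: 1 :: 1 :: l) (fun _ => f) x w =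
      (1 - p) ^ 2 * runExp p l (fun _ => bernStep p f) 0 w +
      p * (1 - p) * runExp p l (fun _ => f) 1 (w + 1) +
      p ^ 2 * runExp p l (fun _ => bernStep (1 - p) f) 1 (w + (1 - x)) +
      p * (1 - p) * runExp p l (fun _ => f) 0 (w + (1 - x)) := by
  simp only [runExp_bernStep, runExp_cons, bernStep, sub_self, sub_zero, mul_one, mul_zero,
    add_zero, one_mul]
  ring

/-- The weights `l` smooth at least as well as a number `S` of independent Bernoulli variables of
variance `p (1 - p)`, where `S` is itself binomial with parameters `M` and `p² + (1 - p)²`. The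
functions tested are those already smoothed `i + j` times. -/
def Smoothing (p μ : ℝ) (M : ℕ) (l : List ℤ) : Prop :=
  ∀ (i j : ℕ) (f : ℤ → ℝ), (∀ w, |f w| ≤ 1) → ∀ x w : ℤ,
    |runExp p l (fun _ => (bernStep p)^[i] ((bernStep (1 - p))^[j] f)) x (w + 1) -
      runExp p l (fun _ => (bernStep p)^[i] ((bernStep (1 - p))^[j] f)) x w| ≤
    μ / 2 + 1 / (μ * (p * (1 - p))) * binomRecip (p ^ 2 + (1 - p) ^ 2) M (i + j)

section

variable {p μ : ℝ} {M : ℕ} {l : List ℤ}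

lemma smoothing_nil (h0 : 0 < p) (h1 : p < 1) (hμ : 0 < μ) : Smoothing p μ 0 [] := by
  intro i j f hf x w
  rw [binomRecip_zero]
  exact abs_bernStep_pair_diff_le h0 h1 hμ i j hf w

lemma Smoothing.cons (h0 : 0 < p) (h1 : p < 1) (h : Smoothing p μ M l) (e : ℤ) :
    Smoothing p μ M (e :: l) := by
  intro i j f hf x w
  have hA := abs_le.1 (h i j f hf 1 (w + e * (1 - x)))
  have hB := abs_le.1 (h i j f hf 0 w)
  have hq : 0 < 1 - p := by linarith
  simp only [runExp_cons]
  rw [add_right_comm w 1, abs_le]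
  constructor <;> nlinarith

lemma Smoothing.three (h0 : 0 < p) (h1 : p < 1) (h : Smoothing p μ M l) :
    Smoothing p μ (M + 1) (1 :: 1 :: 1 :: l) := by
  intro i j f hf x w
  have hq : 0 < 1 - p := by linarith
  have hA := h (i + 1) j f hf 0 w
  have hB := h i j f hf 1 (w + 1)
  have hC := h i (j + 1) f hf 1 (w + (1 - x))
  have hD := h i j f hf 0 (w + (1 - x))
  have hcomm : (bernStep p)^[i] ((bernStep (1 - p))^[j + 1] f) =
      bernStep (1 - p) ((bernStep p)^[i] ((bernStep (1 - p))^[j] f)) := by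
    rw [Function.iterate_succ_apply']
    exact (bernStep_comm p (1 - p)).iterate_left i _
  rw [Function.iterate_succ_apply', add_right_comm i 1 j] at hA
  rw [hcomm, ← add_assoc] at hC
  rw [runExp_three, runExp_three, add_right_comm w 1 (1 - x), binomRecip_succ]
  rw [abs_le] at *
  have hpq : 0 < p * (1 - p) := mul_pos h0 hq
  constructor
  · linarith [mul_le_mul_of_nonneg_left hA.1 (sq_nonneg (1 - p)),
      mul_le_mul_of_nonneg_left hB.1 hpq.le, mul_le_mul_of_nonneg_left hC.1 (sq_nonneg p),
      mul_le_mul_of_nonneg_left hD.1 hpq.le]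
  · linarith [mul_le_mul_of_nonneg_left hA.2 (sq_nonneg (1 - p)),
      mul_le_mul_of_nonneg_left hB.2 hpq.le, mul_le_mul_of_nonneg_left hC.2 (sq_nonneg p),
      mul_le_mul_of_nonneg_left hD.2 hpq.le]

lemma Smoothing.replicate_append (h0 : 0 < p) (h1 : p < 1) (h : Smoothing p μ M l) (k : ℕ) :
    Smoothing p μ (M + k / 3) (List.replicate k 1 ++ l) := by
  induction k using Nat.strong_induction_on with
  | _ k ih =>
    match k, ih with
    | 0, _ => exact h
    | 1, _ => exact h.cons h0 h1 1
    | 2, _ => exact (h.cons h0 h1 1).cons h0 h1 1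
    | k + 3, ih =>
      have h3 := (ih k (by omega)).three h0 h1
      rwa [add_assoc, ← Nat.add_div_right k (by norm_num : 0 < 3)] at h3

/-- The resulting bound on second differences, each a difference of two first differences. -/
lemma Smoothing.abs_second_diff_le (h0 : 0 < p) (h1 : p < 1) (hμ : 0 < μ) (h : Smoothing p μ M l)
    {f : ℤ → ℝ} (hf : ∀ w, |f w| ≤ 1) (x w : ℤ) :
    |runExp p l (fun _ v => f (v + 2) - 2 * f (v + 1) + f v) x w| ≤
      μ + 4 / (μ * (p * (1 - p)) * (M + 1)) := by
  have hq : 0 < 1 - p := by linarith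
  have hM : (0 : ℝ) < M + 1 := by positivity
  have hfun : (fun (_ v : ℤ) => f (v + 2) - 2 * f (v + 1) + f v) =
      fun _ v => (fun u => f (u + 1) - f u) (v + 1) - (fun u => f (u + 1) - f u) v := by
    funext _ v
    simp only [add_assoc, one_add_one_eq_two]
    ring
  rw [hfun, runExp_diff p l (fun u => f (u + 1) - f u), runExp_diff, runExp_diff]
  have hA := h 0 0 f hf x (w + 1)
  have hB := h 0 0 f hf x w
  simp only [Function.iterate_zero, id, add_zero] at hA hB
  have hr : 1 / 2 ≤ p ^ 2 + (1 - p) ^ 2 := by nlinarith [sq_nonneg (2 * p - 1)]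
  have hrec : binomRecip (p ^ 2 + (1 - p) ^ 2) M 0 ≤ 2 / (M + 1) := by
    refine (binomRecip_le (by linarith) (by nlinarith) M).trans ?_
    rw [div_le_div_iff₀ (by positivity) hM]
    nlinarith
  have hfin : 1 / (μ * (p * (1 - p))) * binomRecip (p ^ 2 + (1 - p) ^ 2) M 0 ≤
      2 / (μ * (p * (1 - p)) * (M + 1)) := by
    refine (mul_le_mul_of_nonneg_left hrec (by positivity)).trans_eq ?_
    field_simp
  refine (abs_sub _ _).trans ?_
  have h4 : (4 : ℝ) / (μ * (p * (1 - p)) * (M + 1)) = 2 * (2 / (μ * (p * (1 - p)) * (M + 1))) := by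
    ring
  rw [h4]
  linarith

end

/-! ### Second differences of a law, by duality -/

lemma conv_apply (f g : ℤ → ℝ) (k : ℤ) : conv f g k = ∑' b, f (k - b) * g b := by
  let e : ℤ ≃ DiscreteConvolution.addFiber k :=
    { toFun := fun b => ⟨(k - b, b), by simp [DiscreteConvolution.mem_addFiber]⟩
      invFun := fun x => x.1.2
      left_inv := fun b => rfl
      right_inv := by
        rintro ⟨⟨x, y⟩, h⟩
        rw [DiscreteConvolution.mem_addFiber] at h
        ext
        · simp only at h ⊢
          omega
        · rfl }
  exact (e.tsum_eq _).symm

lemma diffMeasure_apply (k : ℤ) :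
    diffMeasure k = (if k = 1 then 1 else 0) - if k = 0 then 1 else 0 := by
  simp [diffMeasure, degenerate, Pi.single_apply]

lemma conv_diffMeasure (f : ℤ → ℝ) (k : ℤ) : conv f diffMeasure k = f (k - 1) - f k := by
  rw [conv_apply, tsum_eq_sum (s := {0, 1})]
  · simp [diffMeasure_apply]
    ring
  · intro b hb
    simp only [Finset.mem_insert, Finset.mem_singleton, not_or] at hb
    simp [diffMeasure_apply, hb]

lemma conv_diffMeasure_sq (f : ℤ → ℝ) (k : ℤ) :
    conv f (conv diffMeasure diffMeasure) k = f (k - 2) - 2 * f (k - 1) + f k := by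
  rw [conv_apply, tsum_eq_sum (s := {0, 1, 2})]
  · simp [conv_diffMeasure, diffMeasure_apply]
    ring
  · intro b hb
    simp only [Finset.mem_insert, Finset.mem_singleton, not_or] at hb
    have h1 : b - 1 ≠ 1 := by omega
    have h2 : b - 1 ≠ 0 := by omega
    simp [conv_diffMeasure, diffMeasure_apply, hb, h1, h2]

section

variable {Ω : Type*} [MeasurableSpace Ω] {P : Measure Ω} [IsProbabilityMeasure P]

lemma integrable_of_abs_le {Y : Ω → ℤ} (hY : AEMeasurable Y P) {f : ℤ → ℝ} {C : ℝ}
    (hf : ∀ k, |f k| ≤ C) : Integrable (fun ω => f (Y ω)) P :=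
  Integrable.of_bound
    ((measurable_of_countable f).comp_aemeasurable hY).aestronglyMeasurable C
    (ae_of_all _ fun _ => hf _)

lemma hasSum_law_mul {Y : Ω → ℤ} (hY : AEMeasurable Y P) {f : ℤ → ℝ} {C : ℝ}
    (hf : ∀ k, |f k| ≤ C) : HasSum (fun k => law P Y k * f k) (∫ ω, f (Y ω) ∂P) := by
  have : IsProbabilityMeasure (P.map Y) := Measure.isProbabilityMeasure_map hY
  have hint : Integrable f (P.map Y) :=
    Integrable.of_bound (measurable_of_countable f).aestronglyMeasurable C (ae_of_all _ hf)
  have hlaw : ∀ k, law P Y k = (P.map Y).real {k} := by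
    intro k
    rw [map_measureReal_apply_of_aemeasurable hY (measurableSet_singleton k)]
    rfl
  have hsum : Summable fun k => (P.map Y).real {k} * f k := by
    have h := hint
    rw [← Measure.sum_smul_dirac (P.map Y)] at h
    have h2 := (hasSum_integral_measure h).summable
    refine h2.congr fun k => ?_
    simp [integral_smul_measure, integral_dirac, measureReal_def]
  rw [← integral_map hY (measurable_of_countable f).aestronglyMeasurable, integral_countable hint]
  simp only [hlaw, smul_eq_mul]
  exact hsum.hasSum

/-- Duality: the total variation of the second difference of the law of `Y` is attained on a test
function with values in `[-1, 1]`, namely on its sign. -/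
lemma exists_secondDiffNorm_eq {Y : Ω → ℤ} (hY : AEMeasurable Y P) :
    ∃ f : ℤ → ℝ, (∀ k, |f k| ≤ 1) ∧
      secondDiffNorm P Y = ∫ ω, (f (Y ω + 2) - 2 * f (Y ω + 1) + f (Y ω)) ∂P := by
  set g : ℤ → ℝ := conv (law P Y) (conv diffMeasure diffMeasure) with hg
  have hf : ∀ k, |(SignType.sign (g k) : ℝ)| ≤ 1 := by
    intro k
    rcases lt_trichotomy (g k) 0 with h | h | h <;> simp [h]
  refine ⟨fun k => SignType.sign (g k), hf, ?_⟩
  set f : ℤ → ℝ := fun k => SignType.sign (g k)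
  have h0 := hasSum_law_mul hY (f := f) hf
  have h1 := hasSum_law_mul hY (f := fun k => f (k + 1)) fun k => hf _
  have h2 := hasSum_law_mul hY (f := fun k => f (k + 2)) fun k => hf _
  have h1' := (Equiv.subRight (1 : ℤ)).hasSum_iff.2 h1
  have h2' := (Equiv.subRight (2 : ℤ)).hasSum_iff.2 h2
  have hsum := (h2'.sub (h1'.mul_left 2)).add h0
  have hterm : ∀ k, |g k| = ((fun k => law P Y k * f (k + 2)) ∘ Equiv.subRight (2 : ℤ)) k -
      2 * ((fun k => law P Y k * f (k + 1)) ∘ Equiv.subRight (1 : ℤ)) k + law P Y k * f k := by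
    intro k
    have hk : g k = law P Y (k - 2) - 2 * law P Y (k - 1) + law P Y k :=
      conv_diffMeasure_sq _ k
    have habs : |g k| = g k * f k := (self_mul_sign (g k)).symm
    simp only [Function.comp_apply, Equiv.subRight_apply, sub_add_cancel]
    rw [habs]
    linear_combination f k * hk
  rw [secondDiffNorm, tvNorm, ← hg, tsum_congr hterm, hsum.tsum_eq,
    integral_add, integral_sub, integral_const_mul]
  · exact integrable_of_abs_le hY (f := fun k => f (k + 2)) fun k => hf _
  · exact (integrable_of_abs_le hY (f := fun k => f (k + 1)) fun k => hf _).const_mul 2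
  · exact (integrable_of_abs_le hY (f := fun k => f (k + 2)) fun k => hf _).sub
      ((integrable_of_abs_le hY (f := fun k => f (k + 1)) fun k => hf _).const_mul 2)
  · exact integrable_of_abs_le hY hf

end

/-! ### The chain of partial counts -/

section

variable {Ω : Type*}

/-- The weighted count `∑_{j=2}^k ε_j 𝕀_j`. -/
def weightedRuns (ε : ℕ → ℤ) (X : ℕ → Ω → ℤ) (k : ℕ) : Ω → ℤ :=
  fun ω => ∑ j ∈ Finset.Icc 2 k, ε j * runInd X j ω

lemma weightedRuns_succ (ε : ℕ → ℤ) (X : ℕ → Ω → ℤ) (m : ℕ) (ω : Ω) :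
    weightedRuns ε X (m + 2) ω =
      weightedRuns ε X (m + 1) ω + ε (m + 2) * (X (m + 2) ω * (1 - X (m + 1) ω)) := by
  simp only [weightedRuns]
  rw [Finset.sum_Icc_succ_top (by omega)]
  rfl

lemma W_eq_weightedRuns (X : ℕ → Ω → ℤ) (n : ℕ) : W X n = weightedRuns (fun _ => 1) X n := by
  funext ω
  simp [W, weightedRuns]

lemma Wdel_eq_weightedRuns (X : ℕ → Ω → ℤ) {n i : ℕ} (hi : i ∈ Finset.Icc 2 n) :
    Wdel X n i = weightedRuns (fun j => if j = i then 0 else 1) X n := by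
  funext ω
  simp only [Wdel, W, weightedRuns]
  rw [← Finset.add_sum_erase _ _ hi, ← Finset.add_sum_erase (Finset.Icc 2 n)
    (fun j => (if j = i then (0 : ℤ) else 1) * runInd X j ω) hi]
  simp only [if_true, zero_mul, zero_add, add_sub_cancel_left]
  refine Finset.sum_congr rfl fun j hj => ?_
  rw [if_neg (Finset.ne_of_mem_erase hj), one_mul]

lemma aemeasurable_weightedRuns [MeasurableSpace Ω] {P : Measure Ω} {X : ℕ → Ω → ℤ}
    (hX : ∀ j, 1 ≤ j → AEMeasurable (X j) P)
    (ε : ℕ → ℤ) (k : ℕ) :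
    AEMeasurable (weightedRuns ε X k) P := by
  refine Finset.aemeasurable_fun_sum _ fun j hj => ?_
  have h2 := (Finset.mem_Icc.1 hj).1
  exact ((hX j (by omega)).mul ((hX (j - 1) (by omega)).const_sub 1)).const_mul _

/-- The new variable is independent of the past of the chain. -/
lemma indepFun_chain [MeasurableSpace Ω] {P : Measure Ω} {X : ℕ → Ω → ℤ}
    (hX : ∀ j, 1 ≤ j → AEMeasurable (X j) P)
    (hIndep : iIndepFun (fun j : Set.Ici (1 : ℕ) => X j) P) (ε : ℕ → ℤ) (m : ℕ) :
    IndepFun (fun ω => (X (m + 1) ω, weightedRuns ε X (m + 1) ω)) (X (m + 2)) P := by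
  classical
  set S : Finset (Set.Ici (1 : ℕ)) := (Finset.Icc 1 (m + 1)).subtype (· ∈ Set.Ici 1) with hS
  set t : Set.Ici (1 : ℕ) := ⟨m + 2, by simp⟩ with ht
  have hmem : ∀ j (h1 : 1 ≤ j), j ≤ m + 1 → (⟨j, h1⟩ : Set.Ici (1 : ℕ)) ∈ S := by
    intro j h1 h2
    simp [hS, h1, h2]
  have hdisj : Disjoint S {t} := by
    simp [hS, ht]
  have h := hIndep.indepFun_finset₀ S {t} hdisj fun i => hX i i.2
  let Z : (S → ℤ) → ℕ → ℤ := fun v j =>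
    if hj : 1 ≤ j ∧ j ≤ m + 1 then v ⟨⟨j, hj.1⟩, hmem j hj.1 hj.2⟩ else 0
  have h' := h.comp
    (φ := fun v => (Z v (m + 1),
      ∑ j ∈ Finset.Icc 2 (m + 1), ε j * (Z v j * (1 - Z v (j - 1)))))
    (ψ := fun v => v ⟨t, by simp⟩) (measurable_of_countable _) (measurable_of_countable _)
  refine h'.congr (ae_of_all _ fun ω => ?_) (ae_of_all _ fun _ => rfl)
  have hZ : ∀ j, 1 ≤ j → j ≤ m + 1 → Z (fun i : S => X i ω) j = X j ω := by
    intro j h1 h2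
    simp [Z, h1, h2]
  simp only [Function.comp_apply]
  rw [hZ _ (by omega) le_rfl]
  congr 1
  refine Finset.sum_congr rfl fun j hj => ?_
  have hj' := Finset.mem_Icc.1 hj
  rw [hZ j (by omega) hj'.2, hZ (j - 1) (by omega) (by omega)]
  rfl

end

section

variable {Ω : Type*} [MeasurableSpace Ω] {P : Measure Ω} [IsProbabilityMeasure P]
  {p : unitInterval} {X : ℕ → Ω → ℤ}

lemma abs_runStep_le (p : unitInterval) (e : ℤ) {F : ℤ → ℤ → ℝ} {C : ℝ}
    (hF : ∀ x w, |F x w| ≤ C) (x w : ℤ) : |runStep p e F x w| ≤ C := by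
  have h1 := abs_le.1 (hF 1 (w + e * (1 - x)))
  have h2 := abs_le.1 (hF 0 w)
  have hp0 := p.2.1
  have hp1 : 0 ≤ 1 - (p : ℝ) := sub_nonneg.2 p.2.2
  rw [abs_le, runStep]
  constructor <;> nlinarith

lemma integral_runStep (hBer : ∀ j, 1 ≤ j → HasLaw (X j) (bernoulliMeasure (1 : ℤ) (0 : ℤ) p) P)
    (hIndep : iIndepFun (fun j : Set.Ici (1 : ℕ) => X j) P) (ε : ℕ → ℤ) (m : ℕ)
    {F : ℤ → ℤ → ℝ} {C : ℝ} (hF : ∀ x w, |F x w| ≤ C) :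
    ∫ ω, F (X (m + 2) ω) (weightedRuns ε X (m + 2) ω) ∂P =
      ∫ ω, runStep p (ε (m + 2)) F (X (m + 1) ω) (weightedRuns ε X (m + 1) ω) ∂P := by
  have hX : ∀ j, 1 ≤ j → AEMeasurable (X j) P := fun j hj => (hBer j hj).aemeasurable
  have hpast : AEMeasurable (fun ω => (X (m + 1) ω, weightedRuns ε X (m + 1) ω)) P :=
    (hX _ (by omega)).prodMk (aemeasurable_weightedRuns hX ε _)
  have hnew := hX (m + 2) (by omega)
  let G : (ℤ × ℤ) × ℤ → ℝ := fun z => F z.2 (z.1.2 + ε (m + 2) * (z.2 * (1 - z.1.1)))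
  have hmap := (indepFun_iff_map_prod_eq_prod_map_map hpast hnew).1
    (indepFun_chain hX hIndep ε m)
  have : IsProbabilityMeasure (P.map fun ω => (X (m + 1) ω, weightedRuns ε X (m + 1) ω)) :=
    Measure.isProbabilityMeasure_map hpast
  have : IsProbabilityMeasure (P.map (X (m + 2))) := Measure.isProbabilityMeasure_map hnew
  have hG : Integrable G ((P.map fun ω => (X (m + 1) ω, weightedRuns ε X (m + 1) ω)).prod
      (P.map (X (m + 2)))) :=
    Integrable.of_bound (measurable_of_countable G).aestronglyMeasurable C
      (ae_of_all _ fun z => hF _ _)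
  calc ∫ ω, F (X (m + 2) ω) (weightedRuns ε X (m + 2) ω) ∂P
      = ∫ ω, G ((X (m + 1) ω, weightedRuns ε X (m + 1) ω), X (m + 2) ω) ∂P := by
        simp only [G, weightedRuns_succ]
    _ = ∫ y, ∫ z, G (y, z) ∂(P.map (X (m + 2)))
          ∂(P.map fun ω => (X (m + 1) ω, weightedRuns ε X (m + 1) ω)) := by
        rw [← integral_prod _ hG, ← hmap, integral_map (hpast.prodMk hnew)
          (measurable_of_countable G).aestronglyMeasurable]
    _ = ∫ y : ℤ × ℤ, runStep p (ε (m + 2)) F y.1 y.2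
          ∂(P.map fun ω => (X (m + 1) ω, weightedRuns ε X (m + 1) ω)) := by
        refine integral_congr_ae (ae_of_all _ fun y => ?_)
        simp only [(hBer (m + 2) (by omega)).map_eq, integral_bernoulliMeasure, G, runStep]
        simp
    _ = _ := integral_map hpast (measurable_of_countable _).aestronglyMeasurable

/-- The chain run from its first variable. -/
lemma integral_weightedRuns
    (hBer : ∀ j, 1 ≤ j → HasLaw (X j) (bernoulliMeasure (1 : ℤ) (0 : ℤ) p) P)
    (hIndep : iIndepFun (fun j : Set.Ici (1 : ℕ) => X j) P) (ε : ℕ → ℤ) (m : ℕ)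
    {F : ℤ → ℤ → ℝ} {C : ℝ} (hF : ∀ x w, |F x w| ≤ C) :
    ∫ ω, F (X (m + 1) ω) (weightedRuns ε X (m + 1) ω) ∂P =
      ∫ ω, runExp p ((List.range' 2 m).map ε) F (X 1 ω) 0 ∂P := by
  induction m generalizing F with
  | zero => simp [weightedRuns, runExp]
  | succ m ih =>
    rw [integral_runStep hBer hIndep ε m hF, ih (abs_runStep_le p _ hF), List.range'_concat,
      List.map_append, List.map_singleton, runExp_append_singleton, one_mul, add_comm 2 m]

lemma secondDiffNorm_weightedRuns_le
    (hBer : ∀ j, 1 ≤ j → HasLaw (X j) (bernoulliMeasure (1 : ℤ) (0 : ℤ) p) P)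
    (hIndep : iIndepFun (fun j : Set.Ici (1 : ℕ) => X j) P) (ε : ℕ → ℤ) {m M : ℕ} {μ : ℝ}
    (h0 : 0 < (p : ℝ)) (h1 : (p : ℝ) < 1) (hμ : 0 < μ)
    (h : Smoothing p μ M ((List.range' 2 m).map ε)) :
    secondDiffNorm P (weightedRuns ε X (m + 1)) ≤ μ + 4 / (μ * a p * (M + 1)) := by
  obtain ⟨f, hf, heq⟩ := exists_secondDiffNorm_eq (P := P) (aemeasurable_weightedRuns
    (fun j hj => (hBer j hj).aemeasurable) ε (m + 1))
  have hbd : ∀ _ w : ℤ, |f (w + 2) - 2 * f (w + 1) + f w| ≤ 4 := by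
    intro _ w
    have h1 := abs_le.1 (hf (w + 2))
    have h2 := abs_le.1 (hf (w + 1))
    have h3 := abs_le.1 (hf w)
    rw [abs_le]
    constructor <;> linarith
  rw [heq, integral_weightedRuns hBer hIndep ε m
    (F := fun _ w => f (w + 2) - 2 * f (w + 1) + f w) hbd]
  refine (le_abs_self _).trans ?_
  have := norm_integral_le_of_norm_le_const (μ := P) (ae_of_all P fun ω =>
    (Real.norm_eq_abs _).trans_le (h.abs_second_diff_le h0 h1 hμ hf (X 1 ω) 0))
  simpa [a] using this

end

/-! ### The bound for the full and the deleted counts -/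

lemma smoothing_all {p μ : ℝ} (h0 : 0 < p) (h1 : p < 1) (hμ : 0 < μ) (m : ℕ) :
    Smoothing p μ (m / 3) ((List.range' 2 m).map fun _ => 1) := by
  have h := (smoothing_nil h0 h1 hμ).replicate_append h0 h1 m
  rwa [zero_add, List.append_nil, ← List.length_range' (s := 2) (n := m) (step := 1),
    ← List.map_const', List.length_range'] at h

lemma smoothing_deleted {p μ : ℝ} (h0 : 0 < p) (h1 : p < 1) (hμ : 0 < μ) (k l : ℕ) :
    Smoothing p μ (l / 3 + k / 3)
      ((List.range' 2 (k + (l + 1))).map fun j => if j = k + 2 then 0 else 1) := by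
  have h := (((smoothing_nil h0 h1 hμ).replicate_append h0 h1 l).cons h0 h1 0).replicate_append
    h0 h1 k
  rw [zero_add, List.append_nil] at h
  convert h using 1
  refine List.ext_getElem (by simp) fun i hi _ => ?_
  simp only [List.getElem_map, List.getElem_range', List.getElem_append, List.length_replicate,
    List.getElem_replicate, List.getElem_cons]
  split_ifs <;> first | rfl | omega

/-- Choice of the free parameter: `μ = 2 / (b √(1/2) √m)` is half of the target, and the other half
absorbs the variance term as soon as `b m ≤ 2 (M + 1)`. -/
lemma exists_smoothing_parameter {b m M : ℝ} (hb0 : 0 < b) (hb : b ≤ 1 / 4) (hm : 0 < m)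
    (hM : m ≤ 8 * (M + 1)) :
    ∃ μ : ℝ, 0 < μ ∧ μ + 4 / (μ * b * (M + 1)) ≤ 4 / (b * √(1 / 2)) / √m := by
  have hc : 0 < √(1 / 2 : ℝ) := by positivity
  have hc2 : √(1 / 2 : ℝ) ^ 2 = 1 / 2 := Real.sq_sqrt (by norm_num)
  have hs : 0 < √m := Real.sqrt_pos.2 hm
  have hs2 : √m ^ 2 = m := Real.sq_sqrt hm.le
  have hM0 : 0 < M + 1 := by linarith
  set c := √(1 / 2 : ℝ)
  set s := √m
  refine ⟨2 / (b * c * s), by positivity, ?_⟩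
  have h1 : 4 / (2 / (b * c * s) * b * (M + 1)) = 2 * c * s / (M + 1) := by
    field_simp
    ring
  have h2 : 4 / (b * c) / s = 2 / (b * c * s) + 2 / (b * c * s) := by
    field_simp
    ring
  rw [h1, h2]
  refine add_le_add_right ?_ _
  rw [div_le_div_iff₀ hM0 (by positivity)]
  have h3 : 2 * c * s * (b * c * s) = 2 * c ^ 2 * (b * s ^ 2) := by ring
  rw [h3, hc2, hs2]
  nlinarith

lemma a_le (q : ℝ) : a q ≤ 1 / 4 := by
  unfold a
  nlinarith [sq_nonneg (2 * q - 1)]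

lemma K₂_eq (q : ℝ) : K₂ q = 4 / (a q * √(1 / 2)) := by
  have := a_le q
  rw [K₂, min_eq_right (by linarith)]

lemma K₁_nonneg {q : ℝ} (hq : 0 < a q) : 0 ≤ K₁ q := by
  have := a_le q
  exact div_nonneg (by linarith) hq.le

end Runs

theorem lemma4p7 {Ω : Type*} [MeasurableSpace Ω] (P : Measure Ω) [IsProbabilityMeasure P]
    (p : unitInterval) (X : ℕ → Ω → ℤ)
    (hBer : ∀ j : ℕ, 1 ≤ j → HasLaw (X j) (bernoulliMeasure (1 : ℤ) (0 : ℤ) p) P)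
    (hIndep : iIndepFun (fun j : Set.Ici (1 : ℕ) => X j) P)
    (n : ℕ) (hn : 8 ≤ ((n : ℝ) - 2) * Runs.a p) :
    Runs.d P X n ≤ Runs.K₁ p / ((n : ℝ) - 1) + Runs.K₂ p / √((n : ℝ) - 1) ∧
    Runs.d₁ P X n ≤ Runs.K₁ p / ((n : ℝ) - 2) + Runs.K₂ p / √((n : ℝ) - 2) := by
  have hp0 := p.2.1
  have hp1 := p.2.2
  have ha_nonneg : 0 ≤ Runs.a p := mul_nonneg hp0 (by linarith)
  have ha : 0 < Runs.a p := by
    refine ha_nonneg.lt_of_ne fun h => ?_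
    rw [← h] at hn
    norm_num at hn
  have ha4 := Runs.a_le p
  have h0 : 0 < (p : ℝ) := hp0.lt_of_ne fun h => by simp [Runs.a, ← h] at ha
  have h1 : (p : ℝ) < 1 := hp1.lt_of_ne fun h => by simp [Runs.a, h] at ha
  have hn32 : (32 : ℝ) ≤ n - 2 := by nlinarith
  have hn34 : 34 ≤ n := by
    have : (34 : ℝ) ≤ n := by linarith
    exact_mod_cast this
  obtain ⟨m, rfl⟩ : ∃ m, n = m + 1 := ⟨n - 1, by omega⟩
  have hK := Runs.K₁_nonneg ha
  rw [Runs.K₂_eq]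
  constructor
  · have hmM : (((m + 1 : ℕ) : ℝ) - 1) ≤ 8 * (((m / 3 : ℕ) : ℝ) + 1) := by
      have : m ≤ 8 * (m / 3 + 1) := by omega
      push_cast
      rw [add_sub_cancel_right]
      exact_mod_cast this
    obtain ⟨μ, hμ, hμ'⟩ := Runs.exists_smoothing_parameter ha ha4 (by linarith) hmM
    have := Runs.secondDiffNorm_weightedRuns_le hBer hIndep (fun _ => 1) h0 h1 hμ
      (Runs.smoothing_all h0 h1 hμ m)
    rw [Runs.d, Runs.W_eq_weightedRuns]
    refine (this.trans hμ').trans (le_add_of_nonneg_left (div_nonneg hK (by linarith)))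
  · have : Nonempty (Finset.Icc 2 (m + 1)) := ⟨⟨2, by simp; omega⟩⟩
    refine ciSup_le ?_
    rintro ⟨i, hi⟩
    have hi' := Finset.mem_Icc.1 hi
    obtain ⟨k, rfl⟩ : ∃ k, i = k + 2 := ⟨i - 2, by omega⟩
    obtain ⟨l, rfl⟩ : ∃ l, m = k + (l + 1) := ⟨m - k - 1, by omega⟩
    have hmM : (((k + (l + 1) + 1 : ℕ) : ℝ) - 2) ≤ 8 * (((l / 3 + k / 3 : ℕ) : ℝ) + 1) := by
      have : k + l ≤ 8 * (l / 3 + k / 3 + 1) := by omega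
      have h' : ((k + l : ℕ) : ℝ) ≤ ((8 * (l / 3 + k / 3 + 1) : ℕ) : ℝ) := by exact_mod_cast this
      push_cast at h' ⊢
      linarith
    obtain ⟨μ, hμ, hμ'⟩ := Runs.exists_smoothing_parameter ha ha4 (by linarith) hmM
    have := Runs.secondDiffNorm_weightedRuns_le hBer hIndep _ h0 h1 hμ
      (Runs.smoothing_deleted h0 h1 hμ k l)
    rw [Runs.Wdel_eq_weightedRuns X hi]
    refine (this.trans hμ').trans (le_add_of_nonneg_left (div_nonneg hK (by linarith)))
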